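/- \textbf{Theorem (Existence).} Let $Y$ be a separable real normed space and let $X=Y^*$ be its dual, with the dual norm. Let $F\subset X$ be a nonempty finite set, and let $w:X\to(0,+\infty]$ be lower semicontinuous with respect to the weak* topology $\sigma(X,Y)$, with $\inf_X w>0$. Let $\mathscr C_F$ denote the collection of all (norm-)compact connected sets $C\subset X$ with $F\subset C$, let $\mathscr H^1$ be the one-dimensional Hausdorff measure on $X$ relative to the norm metric, and set $\mathscr L_w(C)=\int_C w\,d\mathscr H^1\in[0,+\infty]$ for $C\in\mathscr C_F$. If $\inf_{C\in\mathscr C_F}\mathscr L_w(C)<\infty$, then there exists $C\in\mathscr C_F$ such that $\mathscr L_w(C)\le\mathscr L_w(C')$ for every $C'\in\mathscr C_F$. -/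

import Mathlib

open MeasureTheory
open scoped ENNReal

/-- The weighted length `∫_C w dℋ¹`, where `ℋ¹` is the one-dimensional Hausdorff measure of the
metric of `X` and the weight `w` has values in `[0, +∞]`. -/
noncomputable def weightedLength {X : Type*} [MetricSpace X] [MeasurableSpace X] [BorelSpace X]
    (w : X → ℝ≥0∞) (C : Set X) : ℝ≥0∞ :=
  ∫⁻ x in C, w x ∂(Measure.hausdorffMeasure 1 : Measure X)

/-- The competitors of the Steiner problem: the compact connected sets containing `F`. -/
def steinerCompetitors {X : Type*} [TopologicalSpace X] (F : Set X) : Set (Set X) :=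
  {C | IsCompact C ∧ IsConnected C ∧ F ⊆ C}

/-- The infimum of the weighted length over the competitors. -/
noncomputable def steinerInf {X : Type*} [MetricSpace X] [MeasurableSpace X] [BorelSpace X]
    (F : Set X) (w : X → ℝ≥0∞) : ℝ≥0∞ :=
  ⨅ C ∈ steinerCompetitors F, weightedLength w C

/-- `C` solves the weighted Steiner problem: it is a competitor, and its weighted length is at most
that of every competitor. -/
def IsSteinerMinimizer {X : Type*} [MetricSpace X] [MeasurableSpace X] [BorelSpace X]
    (F : Set X) (w : X → ℝ≥0∞) (C : Set X) : Prop :=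
  C ∈ steinerCompetitors F ∧ ∀ C' ∈ steinerCompetitors F, weightedLength w C ≤ weightedLength w C'

/-- Lower semicontinuity of `w : Y* → [0, +∞]` for the weak* topology of the dual `Y*`, that is,
the topology of pointwise convergence on `Y` (carried by the type synonym `WeakDual ℝ Y`). -/
def WeakStarLowerSemicontinuous {Y : Type*} [NormedAddCommGroup Y] [NormedSpace ℝ Y]
    (w : StrongDual ℝ Y → ℝ≥0∞) : Prop :=
  LowerSemicontinuous fun x : WeakDual ℝ Y => w (WeakDual.toStrongDual x)

/-! A minimizing sequence of continua need not be precompact in norm, so the direct method is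
applied to finitely many curves instead of to sets. Since `inf w > 0`, the continua have uniformly
bounded length. Each contains a tree of curves, one per point of `F`, every curve ending on an
earlier one; the weighted length of the tree, counted curve by curve, is at most that of the
continuum (`exists_isCurveTree`). Each curve is a Lipschitz-minimal connection to the part already
built: minimality makes it injective, of constant speed, and disjoint from that part except at its
end, so lengths add.

The Lipschitz constants are bounded and each starting point is fixed. Banach–Alaoglu therefore gives
weak* limits at every time, and separability of `Y` gives a single subsequence
(`exists_weakStar_limit_curveTree`). The dual norm is weak* lower semicontinuous, so the limit
curves are norm-Lipschitz and their union is norm-compact and connected. Fatou's lemma and the lower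
semicontinuity of `w` bound the limit length (`curveTreeLength_le_liminf`); overlaps in the limit
only shorten the union. -/

open Filter Topology Set
open scoped NNReal

/-! ### Chains and Lipschitz curves in continua of finite length -/

section MetricSpace

variable {X : Type*} [MetricSpace X]

/-- The points of `C` that are reached from `x` by at most `k` jumps of length at most `ε`
inside `C`. -/
def chainLevel (C : Set X) (ε : ℝ) (x : X) : ℕ → Set X
  | 0 => {x}
  | k + 1 => {z | z ∈ C ∧ ∃ u ∈ chainLevel C ε x k, dist u z ≤ ε}

/-- Placing each vertex at its first level makes the chain shortest: nonconsecutive vertices are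
then more than `ε` apart, which the packing bound in `exists_chain` needs. -/
theorem exists_chain_of_mem_chainLevel {C : Set X} {ε : ℝ} {x : X} (k : ℕ) (z : X)
    (hz : z ∈ chainLevel C ε x k) (hmin : ∀ i < k, z ∉ chainLevel C ε x i) :
    ∃ v : ℕ → X, v k = z ∧
      (∀ i ≤ k, v i ∈ chainLevel C ε x i ∧ ∀ j < i, v i ∉ chainLevel C ε x j) ∧
      ∀ i < k, dist (v i) (v (i + 1)) ≤ ε := by
  induction k generalizing z with
  | zero => exact ⟨fun _ => z, rfl, by simpa using hz, by simp⟩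
  | succ k ih =>
    obtain ⟨hzC, u, hu, huz⟩ := hz
    obtain ⟨v, hv, hlev, hstep⟩ := ih u hu fun i hi hui =>
      hmin (i + 1) (by omega) ⟨hzC, u, hui, huz⟩
    refine ⟨Function.update v (k + 1) z, by simp, fun i hi => ?_, fun i hi => ?_⟩
    · rcases eq_or_lt_of_le hi with rfl | hi'
      · rw [Function.update_self]
        exact ⟨⟨hzC, u, hu, huz⟩, hmin⟩
      · rw [Function.update_of_ne (by omega)]
        exact hlev i (by omega)
    · rw [Function.update_of_ne (by omega)]
      rcases eq_or_lt_of_le (Nat.le_of_lt_succ hi) with rfl | hi'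
      · rw [Function.update_self, hv]
        exact huz
      · rw [Function.update_of_ne (by omega)]
        exact hstep i hi'

/-- Otherwise the `ε`-balls about reachable and about unreachable points would cover `C`, and a
point of `C` in both unions would link an unreachable point to a reachable one. -/
theorem exists_mem_chainLevel {C : Set X} (hC : IsPreconnected C) {ε : ℝ} (hε : 0 < ε) {x y : X}
    (hx : x ∈ C) (hy : y ∈ C) : ∃ k, y ∈ chainLevel C ε x k := by
  by_contra! hcon
  set U : Set X := {z | ∃ k, z ∈ chainLevel C ε x k} with hU
  have hclosed : ∀ u ∈ U, ∀ z ∈ C, dist u z ≤ ε → z ∈ U := by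
    rintro u ⟨k, hk⟩ z hz huz
    exact ⟨k + 1, hz, u, hk, huz⟩
  have hyU : y ∉ U := fun ⟨k, hk⟩ => hcon k hk
  have hxU : x ∈ U := ⟨0, rfl⟩
  obtain ⟨c, hc, hc1, hc2⟩ := hC (⋃ u ∈ U, Metric.ball u ε) (⋃ u ∈ C \ U, Metric.ball u ε)
    (isOpen_biUnion fun _ _ => Metric.isOpen_ball) (isOpen_biUnion fun _ _ => Metric.isOpen_ball)
    (fun z hz => by
      by_cases h : z ∈ U
      · exact Or.inl (mem_biUnion h (Metric.mem_ball_self hε))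
      · exact Or.inr (mem_biUnion (x := z) ⟨hz, h⟩ (Metric.mem_ball_self hε)))
    ⟨x, hx, mem_biUnion hxU (Metric.mem_ball_self hε)⟩
    ⟨y, hy, mem_biUnion (x := y) ⟨hy, hyU⟩ (Metric.mem_ball_self hε)⟩
  simp only [mem_iUnion, Metric.mem_ball] at hc1 hc2
  obtain ⟨u, hu, huc⟩ := hc1
  obtain ⟨z, hz, hzc⟩ := hc2
  have hcU := hclosed u hu c hc (by rw [dist_comm]; exact huc.le)
  exact hz.2 (hclosed c hcU z hz.1 hzc.le)

/-- Pointwise limits of almost Lipschitz curves in a compact set. -/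
theorem exists_lipschitzWith_of_ultrafilter {C : Set X} (hC : IsCompact C) (σ : ℕ → ℝ → X)
    (hσ : ∀ n t, σ n t ∈ C) (a b : ℕ → ℝ) (L : ℝ≥0)
    (hd : ∀ n s t, dist (σ n s) (σ n t) ≤ a n * |s - t| + b n)
    (ha : Tendsto a atTop (𝓝 L)) (hb : Tendsto b atTop (𝓝 0)) :
    ∃ γ : ℝ → X, LipschitzWith L γ ∧ (∀ t, γ t ∈ C) ∧
      ∀ t, Tendsto (fun n => σ n t) (hyperfilter ℕ : Filter ℕ) (𝓝 (γ t)) := by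
  have hle : (hyperfilter ℕ : Filter ℕ) ≤ atTop := Nat.hyperfilter_le_atTop
  have h : ∀ t, ∃ z ∈ C, Tendsto (fun n => σ n t) (hyperfilter ℕ : Filter ℕ) (𝓝 z) := fun t =>
    hC.ultrafilter_le_nhds ((hyperfilter ℕ).map fun n => σ n t)
      (le_principal_iff.2 (Ultrafilter.mem_map.2 (univ_mem' fun n => hσ n t)))
  choose γ hγC hγ using h
  refine ⟨γ, LipschitzWith.of_dist_le_mul fun s t => ?_, hγC, hγ⟩
  have h1 := (hγ s).dist (hγ t)
  have h2 : Tendsto (fun n => a n * |s - t| + b n) (hyperfilter ℕ : Filter ℕ)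
      (𝓝 (L * |s - t| + 0)) := (((ha.mul_const _).add hb).mono_left hle)
  have h3 := le_of_tendsto_of_tendsto' h1 h2 fun n => hd n s t
  simpa [Real.dist_eq] using h3

variable [MeasurableSpace X] [BorelSpace X]

/-- The distance to `a` is 1-Lipschitz and maps `A` onto a set containing `[0, dist b a]`. -/
theorem edist_le_hausdorffMeasure_of_isPreconnected {A : Set X} (hA : IsPreconnected A) {a b : X}
    (ha : a ∈ A) (hb : b ∈ A) : edist a b ≤ μH[1] A := by
  have h1 : Icc 0 (dist b a) ⊆ (fun z => dist z a) '' A := by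
    refine (hA.image _ (by fun_prop)).Icc_subset ⟨a, ha, by simp⟩ ⟨b, hb, rfl⟩
  have h2 := (LipschitzWith.dist_left a).lipschitzOnWith (s := A)
    |>.hausdorffMeasure_image_le (d := 1) zero_le_one
  have h3 := (measure_mono h1 (μ := μH[1])).trans h2
  rw [hausdorffMeasure_real, Real.volume_Icc] at h3
  simpa [edist_comm a b, edist_dist] using h3

theorem ofReal_le_hausdorffMeasure_inter_ball {C : Set X} (hC : IsPreconnected C) {x y : X}
    (hx : x ∈ C) (hy : y ∈ C) {r : ℝ} (hr : r ≤ dist y x) :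
    ENNReal.ofReal r ≤ μH[1] (C ∩ Metric.ball x r) := by
  have h1 : Ico 0 r ⊆ (fun z => dist z x) '' (C ∩ Metric.ball x r) := by
    intro t ht
    have h0 : Icc 0 (dist y x) ⊆ (fun z => dist z x) '' C :=
      (hC.image _ (by fun_prop)).Icc_subset ⟨x, hx, by simp⟩ ⟨y, hy, rfl⟩
    obtain ⟨z, hz, rfl⟩ := h0 ⟨ht.1, ht.2.le.trans hr⟩
    exact ⟨z, ⟨hz, ht.2⟩, rfl⟩
  have h2 := (LipschitzWith.dist_left x).lipschitzOnWith (s := C ∩ Metric.ball x r)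
    |>.hausdorffMeasure_image_le (d := 1) zero_le_one
  have h3 := (measure_mono h1 (μ := μH[1])).trans h2
  rw [hausdorffMeasure_real, Real.volume_Ico] at h3
  simpa using h3

/-- In a continuum of finite length, two points are joined by `ε`-chains of controlled length. -/
theorem exists_chain {C : Set X} (hC : IsPreconnected C) (hCc : IsClosed C)
    (hfin : μH[1] C ≠ ∞) {ε : ℝ} (hε : 0 < ε) {x y : X} (hx : x ∈ C) (hy : y ∈ C) :
    ∃ (n : ℕ) (v : ℕ → X), v 0 = x ∧ v n = y ∧ (∀ i, v i ∈ C) ∧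
      (∀ i, dist (v i) (v (i + 1)) ≤ ε) ∧ n * ε ≤ 4 * (μH[1] C).toReal + ε := by
  classical
  have hex := exists_mem_chainLevel hC hε hx hy
  set n := Nat.find hex with hn
  obtain ⟨v, hvn, hlev, hstep⟩ := exists_chain_of_mem_chainLevel n y (Nat.find_spec hex)
    fun i hi => Nat.find_min hex hi
  have hvC : ∀ i ≤ n, v i ∈ C := by
    intro i hi
    have := (hlev i hi).1
    cases i with
    | zero => rw [show v 0 = x from this]; exact hx
    | succ i => exact this.1
  -- The chain is frozen at `y` after step `n`, so that its bounds hold for all indices.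
  refine ⟨n, fun i => v (min i n), ?_, ?_, fun i => hvC _ (min_le_right _ _), fun i => ?_, ?_⟩
  · exact (congrArg v (Nat.zero_min n)).trans (hlev 0 (Nat.zero_le _)).1
  · simpa using hvn
  · rcases lt_or_ge i n with hi | hi
    · simpa [min_eq_left hi.le, min_eq_left (Nat.succ_le_of_lt hi)] using hstep i hi
    · simpa [min_eq_right hi, min_eq_right (hi.trans (Nat.le_succ i))] using hε.le
  · have hH : 0 ≤ (μH[1] C).toReal := ENNReal.toReal_nonneg
    rcases lt_or_ge n 2 with h2 | h2
    · have : (n : ℝ) ≤ 1 := by exact_mod_cast Nat.le_of_lt_succ h2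
      nlinarith
    have hsep : ∀ i j, i + 2 ≤ j → j ≤ n → ε < dist (v i) (v j) := by
      intro i j hij hj
      by_contra! hle
      exact (hlev j hj).2 (i + 1) (by omega) ⟨hvC j hj, v i, (hlev i (by omega)).1, hle⟩
    -- The ends are more than `ε` apart, so one of them is at distance at least `ε / 2` from `v i`.
    have hball : ∀ i ≤ n, ENNReal.ofReal (ε / 2) ≤ μH[1] (C ∩ Metric.ball (v i) (ε / 2)) := by
      intro i hi
      have h1 := hsep 0 n (by omega) le_rfl
      have h2 := dist_triangle_right (v 0) (v n) (v i)
      rcases le_or_gt (ε / 2) (dist (v 0) (v i)) with h | h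
      · exact ofReal_le_hausdorffMeasure_inter_ball hC (hvC i hi) (hvC 0 (Nat.zero_le _)) h
      · exact ofReal_le_hausdorffMeasure_inter_ball hC (hvC i hi) (hvC n le_rfl) (by linarith)
    have hdisj : (↑(Finset.range (n / 2 + 1)) : Set ℕ).PairwiseDisjoint
        fun i => C ∩ Metric.ball (v (2 * i)) (ε / 2) := by
      have key : ∀ i j, i < j → j ≤ n / 2 → Disjoint (C ∩ Metric.ball (v (2 * i)) (ε / 2))
          (C ∩ Metric.ball (v (2 * j)) (ε / 2)) := by
        intro i j hij hj
        refine (Metric.ball_disjoint_ball ?_).mono inter_subset_right inter_subset_right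
        have := hsep (2 * i) (2 * j) (by omega) (by omega)
        linarith
      intro i hi j hj hij
      simp only [Finset.coe_range, mem_Iio] at hi hj
      rcases lt_or_gt_of_ne hij with h | h
      · exact key i j h (by omega)
      · exact (key j i h (by omega)).symm
    have hsum : ∑ i ∈ Finset.range (n / 2 + 1), ENNReal.ofReal (ε / 2) ≤ μH[1] C := by
      calc _ ≤ ∑ i ∈ Finset.range (n / 2 + 1), μH[1] (C ∩ Metric.ball (v (2 * i)) (ε / 2)) :=
            Finset.sum_le_sum fun i hi => hball _ (by have := Finset.mem_range.1 hi; omega)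
        _ = μH[1] (⋃ i ∈ Finset.range (n / 2 + 1), C ∩ Metric.ball (v (2 * i)) (ε / 2)) :=
            (measure_biUnion_finset hdisj fun i _ =>
              hCc.measurableSet.inter measurableSet_ball).symm
        _ ≤ _ := measure_mono (by simp)
    have h3 := ENNReal.toReal_mono hfin hsum
    simp only [Finset.sum_const, Finset.card_range, nsmul_eq_mul, ENNReal.toReal_mul,
      ENNReal.toReal_natCast, ENNReal.toReal_ofReal (half_pos hε).le] at h3
    -- Disjoint balls about every second vertex each carry length `ε / 2`: hence the factor 4.
    have h4 : (n : ℝ) ≤ 2 * ((n / 2 + 1 : ℕ) : ℝ) := by exact_mod_cast (by omega)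
    nlinarith

/-- Two points of a continuum of finite length are joined by a Lipschitz curve. -/
theorem exists_lipschitzWith_joining {C : Set X} (hC : IsPreconnected C) (hCc : IsCompact C)
    (hfin : μH[1] C ≠ ∞) {x y : X} (hx : x ∈ C) (hy : y ∈ C) :
    ∃ (L : ℝ≥0) (γ : ℝ → X), LipschitzWith L γ ∧ (∀ t, γ t ∈ C) ∧ γ 0 = x ∧ γ 1 = y := by
  set H := (μH[1] C).toReal with hH
  have hH0 : 0 ≤ H := ENNReal.toReal_nonneg
  have hpos : ∀ N : ℕ, (0 : ℝ) < 1 / ((N : ℝ) + 1) := fun N => by positivity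
  choose n v hv0 hvn hvC hvd hbound using fun N : ℕ =>
    exists_chain hC hCc.isClosed hfin (hpos N) hx hy
  obtain ⟨γ, hγL, hγC, hγ⟩ := exists_lipschitzWith_of_ultrafilter hCc
    -- Step functions along ever finer chains; their jumps give the additive error, which vanishes
    -- in the limit.
    (fun N t => v N ⌊t * n N⌋₊) (fun N t => hvC N _) (fun N => 4 * H + 1)
    (fun N => 1 / ((N : ℝ) + 1)) ⟨4 * H + 1, by positivity⟩
    (fun N s t => by
      have key : ∀ s t : ℝ, s ≤ t → dist (v N ⌊s * n N⌋₊) (v N ⌊t * n N⌋₊) ≤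
          (4 * H + 1) * |s - t| + 1 / ((N : ℝ) + 1) := by
        intro s t hst
        have hmul : s * n N ≤ t * n N := by gcongr
        have hfl : ⌊s * n N⌋₊ ≤ ⌊t * n N⌋₊ := Nat.floor_mono hmul
        have h1 := dist_le_Ico_sum_of_dist_le (f := v N) hfl (d := fun _ => 1 / ((N : ℝ) + 1))
          fun {k} _ _ => hvd N k
        have h2 : ((⌊t * n N⌋₊ - ⌊s * n N⌋₊ : ℕ) : ℝ) ≤ (t - s) * n N + 1 := by
          rw [Nat.cast_sub hfl]
          rcases le_or_gt 0 (t * n N) with h | h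
          · have := Nat.floor_le h
            have := Nat.lt_floor_add_one (s * n N)
            linarith
          · rw [Nat.floor_of_nonpos h.le, Nat.floor_of_nonpos (hmul.trans h.le)]
            simp only [CharP.cast_eq_zero, sub_self]
            linarith
        have h3 : (n N : ℝ) * (1 / ((N : ℝ) + 1)) ≤ 4 * H + 1 := (hbound N).trans (by
          have : 1 / ((N : ℝ) + 1) ≤ 1 := by
            rw [div_le_one (by positivity)]; linarith [Nat.cast_nonneg (α := ℝ) N]
          linarith)
        rw [Finset.sum_const, Nat.card_Ico, nsmul_eq_mul] at h1
        rw [abs_sub_comm, abs_of_nonneg (sub_nonneg.2 hst)]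
        have h4 := mul_le_mul_of_nonneg_right h2 (hpos N).le
        have h5 := mul_le_mul_of_nonneg_left h3 (sub_nonneg.2 hst)
        nlinarith
      rcases le_total s t with h | h
      · exact key s t h
      · rw [dist_comm, abs_sub_comm]; exact key t s h)
    tendsto_const_nhds tendsto_one_div_add_atTop_nhds_zero_nat
  refine ⟨_, γ, hγL, hγC, tendsto_nhds_unique (hγ 0) ?_, tendsto_nhds_unique (hγ 1) ?_⟩
  · simp [hv0]
  · simp [hvn]

end MetricSpace

/-! ### Shortest curves and their arc-length parametrization -/

section ShortestCurve

variable {X : Type*} [MetricSpace X]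

/-- `γ` is a curve in `C` from `x` to `T` with Lipschitz constant `L`. -/
def IsLipschitzJoin (C T : Set X) (x : X) (L : ℝ≥0) (γ : ℝ → X) : Prop :=
  LipschitzWith L γ ∧ (∀ t, γ t ∈ C) ∧ γ 0 = x ∧ γ 1 ∈ T

theorem exists_minimal_isLipschitzJoin {C T : Set X} (hC : IsCompact C) (hT : IsClosed T) {x : X}
    (hne : ∃ L γ, IsLipschitzJoin C T x L γ) :
    ∃ L γ, IsLipschitzJoin C T x L γ ∧ ∀ L' γ', IsLipschitzJoin C T x L' γ' → L ≤ L' := by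
  set S : Set ℝ≥0 := {L | ∃ γ, IsLipschitzJoin C T x L γ} with hS
  obtain ⟨u, -, hu, huS⟩ := exists_seq_tendsto_sInf (S := S) hne (OrderBot.bddBelow S)
  choose γ hγ using huS
  obtain ⟨g, hgL, hgC, hg⟩ := exists_lipschitzWith_of_ultrafilter hC γ (fun n => (hγ n).2.1)
    (fun n => u n) (fun _ => 0) (sInf S) (fun n s t => by
      simpa [Real.dist_eq] using (hγ n).1.dist_le_mul s t)
    (NNReal.tendsto_coe.2 hu) tendsto_const_nhds
  refine ⟨sInf S, g, ⟨hgL, hgC, tendsto_nhds_unique (hg 0) ?_, ?_⟩, fun L' γ' h => ?_⟩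
  · simp [(hγ _).2.2.1]
  · exact hT.mem_of_tendsto (hg 1) (Eventually.of_forall fun n => (hγ n).2.2.2)
  · exact csInf_le (OrderBot.bddBelow S) ⟨γ', h⟩

/-- Stopping at time `s < 1` and rescaling gives the constant `L * s`, so minimality forces `L = 0`
and `γ` is constant. -/
theorem eq_of_mem_of_minimal {C T : Set X} {x : X} {L : ℝ≥0} {γ : ℝ → X}
    (hγ : IsLipschitzJoin C T x L γ) (hmin : ∀ L' γ', IsLipschitzJoin C T x L' γ' → L ≤ L')
    {s : ℝ} (hs : s ∈ Icc (0 : ℝ) 1) (hsT : γ s ∈ T) : γ s = γ 1 := by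
  rcases eq_or_lt_of_le hs.2 with rfl | hs1
  · rfl
  have h := hmin (L * s.toNNReal) (fun t => γ (s * t))
    ⟨LipschitzWith.of_dist_le_mul fun a b => ?_, fun t => hγ.2.1 _, by simpa using hγ.2.2.1,
      by simpa using hsT⟩
  · have hL : L = 0 := by
      by_contra h0
      have h1 : (L : ℝ) ≤ L * s := by
        have := NNReal.coe_le_coe.2 h
        rwa [NNReal.coe_mul, Real.coe_toNNReal _ hs.1] at this
      have h2 : (0 : ℝ) < L := by exact_mod_cast pos_iff_ne_zero.2 h0
      nlinarith
    have h1 := hγ.1.dist_le_mul s 1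
    rw [hL] at h1
    exact dist_le_zero.1 (by simpa using h1)
  · have := hγ.1.dist_le_mul (s * a) (s * b)
    rw [Real.dist_eq, ← mul_sub, abs_mul, abs_of_nonneg hs.1] at this
    refine this.trans_eq ?_
    rw [NNReal.coe_mul, Real.coe_toNNReal _ hs.1, Real.dist_eq, mul_assoc]

theorem injOn_of_minimal {C T : Set X} {x : X} {L : ℝ≥0} {γ : ℝ → X}
    (hγ : IsLipschitzJoin C T x L γ) (hmin : ∀ L' γ', IsLipschitzJoin C T x L' γ' → L ≤ L')
    (hL : L ≠ 0) : InjOn γ (Icc 0 1) := by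
  have key : ∀ s t : ℝ, 0 ≤ s → s < t → t ≤ 1 → γ s ≠ γ t := by
    intro s t hs hst ht heq
    have hr : 0 ≤ 1 - (t - s) := by linarith
    -- Cutting out the loop on `[s, t]` and rescaling gives a smaller Lipschitz constant.
    set g : ℝ → X := fun v => if v ≤ s then γ v else γ (v + (t - s)) with hg
    have hgd : ∀ a b : ℝ, a ≤ b → dist (g a) (g b) ≤ L * |a - b| := by
      intro a b hab
      rw [abs_sub_comm, abs_of_nonneg (sub_nonneg.2 hab)]
      simp only [hg]
      split_ifs with h1 h2 h2
      · have := hγ.1.dist_le_mul a b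
        rwa [Real.dist_eq, abs_sub_comm, abs_of_nonneg (sub_nonneg.2 hab)] at this
      · have h3 := hγ.1.dist_le_mul a s
        have h4 := hγ.1.dist_le_mul t (b + (t - s))
        rw [Real.dist_eq, abs_sub_comm, abs_of_nonneg (sub_nonneg.2 h1)] at h3
        rw [Real.dist_eq, abs_sub_comm, abs_of_nonneg (by linarith)] at h4
        have h5 := dist_triangle (γ a) (γ s) (γ (b + (t - s)))
        rw [heq] at h3 h5
        nlinarith
      · exact absurd (hab.trans h2) h1
      · have := hγ.1.dist_le_mul (a + (t - s)) (b + (t - s))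
        rwa [Real.dist_eq, abs_sub_comm, add_sub_add_right_eq_sub,
          abs_of_nonneg (sub_nonneg.2 hab)] at this
    have hgd' : ∀ a b : ℝ, dist (g a) (g b) ≤ L * |a - b| := by
      intro a b
      rcases le_total a b with h | h
      · exact hgd a b h
      · rw [dist_comm, abs_sub_comm]; exact hgd b a h
    have h := hmin (L * (1 - (t - s)).toNNReal) (fun u => g ((1 - (t - s)) * u))
      ⟨LipschitzWith.of_dist_le_mul fun a b => ?_, fun u => ?_, ?_, ?_⟩
    · have h1 : (L : ℝ) ≤ L * (1 - (t - s)) := by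
        have := NNReal.coe_le_coe.2 h
        rwa [NNReal.coe_mul, Real.coe_toNNReal _ hr] at this
      have h2 : (0 : ℝ) < L := by exact_mod_cast pos_iff_ne_zero.2 hL
      nlinarith
    · have := hgd' ((1 - (t - s)) * a) ((1 - (t - s)) * b)
      rw [← mul_sub, abs_mul, abs_of_nonneg hr] at this
      refine this.trans_eq ?_
      rw [NNReal.coe_mul, Real.coe_toNNReal _ hr, Real.dist_eq, mul_assoc]
    · simp only [hg]
      split_ifs <;> exact hγ.2.1 _
    · simpa [hg, hs] using hγ.2.2.1
    · simp only [hg, mul_one]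
      split_ifs with h1
      · have ht1 : t = 1 := by linarith
        have : 1 - (t - s) = s := by linarith
        rw [this, heq, ht1]
        exact hγ.2.2.2
      · simpa using hγ.2.2.2
  intro s hs t ht heq
  by_contra hne
  rcases lt_or_gt_of_ne hne with h | h
  · exact key s t hs.1 h ht.2 heq
  · exact key t s ht.1 h hs.2 heq.symm

variable [MeasurableSpace X] [BorelSpace X]

theorem hausdorffMeasure_one_singleton (z : X) : μH[1] ({z} : Set X) = 0 :=
  haveI := Measure.nullSingletonClass_hausdorff X (d := 1) zero_lt_one
  measure_singleton z

theorem LipschitzWith.hausdorffMeasure_image_le_volume {L : ℝ≥0} {γ : ℝ → X}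
    (hγ : LipschitzWith L γ) (A : Set ℝ) : μH[1] (γ '' A) ≤ L * volume A := by
  have := (hγ.lipschitzOnWith (s := A)).hausdorffMeasure_image_le (d := 1) zero_le_one
  simpa [hausdorffMeasure_real] using this

/-- Reparametrizing by the length `φ` of the initial arc gives a competitor whose Lipschitz constant
is the length of the image. Injectivity makes `φ` additive over arcs. -/
theorem le_hausdorffMeasure_image_of_minimal {C T : Set X} {x : X} {L : ℝ≥0} {γ : ℝ → X}
    (hγ : IsLipschitzJoin C T x L γ) (hmin : ∀ L' γ', IsLipschitzJoin C T x L' γ' → L ≤ L') :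
    (L : ℝ≥0∞) ≤ μH[1] (γ '' Icc 0 1) := by
  rcases eq_or_ne L 0 with rfl | hL
  · simp
  have hinj := injOn_of_minimal hγ hmin hL
  have hcont := hγ.1.continuous
  have hfin : ∀ a b, μH[1] (γ '' Icc a b) ≠ ∞ := fun a b =>
    ((hγ.1.hausdorffMeasure_image_le_volume _).trans_lt
      (ENNReal.mul_lt_top ENNReal.coe_lt_top (by simp))).ne
  set φ : ℝ → ℝ := fun t => (μH[1] (γ '' Icc 0 t)).toReal with hφ
  have hunion : ∀ s t, 0 ≤ s → s ≤ t → γ '' Icc 0 t = γ '' Icc 0 s ∪ γ '' Icc s t := by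
    intro s t hs hst
    rw [← image_union, Icc_union_Icc_eq_Icc hs hst]
  have hlow : ∀ s t, 0 ≤ s → s ≤ t → t ≤ 1 → dist (γ s) (γ t) ≤ φ t - φ s := by
    intro s t hs hst ht
    have h1 : edist (γ s) (γ t) ≤ μH[1] (γ '' Icc s t) :=
      edist_le_hausdorffMeasure_of_isPreconnected (isPreconnected_Icc.image _ hcont.continuousOn)
        (mem_image_of_mem _ (left_mem_Icc.2 hst)) (mem_image_of_mem _ (right_mem_Icc.2 hst))
    have hmeas : MeasurableSet (γ '' Icc s t) :=
      (isCompact_Icc.image hcont).isClosed.measurableSet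
    have hnull : μH[1] (γ '' Icc 0 s ∩ γ '' Icc s t) = 0 := by
      refine measure_mono_null (t := {γ s}) ?_ (hausdorffMeasure_one_singleton _)
      rintro _ ⟨⟨a, ha, rfl⟩, b, hb, hab⟩
      have := hinj ⟨hs.trans hb.1, hb.2.trans ht⟩ ⟨ha.1, ha.2.trans (hst.trans ht)⟩ hab
      have : a = s := le_antisymm ha.2 (this ▸ hb.1)
      rw [this]; rfl
    have h2 : μH[1] (γ '' Icc 0 t) = μH[1] (γ '' Icc 0 s) + μH[1] (γ '' Icc s t) := by
      have := measure_union_add_inter (μ := μH[1]) (γ '' Icc 0 s) hmeas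
      rwa [hnull, add_zero, ← hunion s t hs hst] at this
    have h3 : φ t = φ s + (μH[1] (γ '' Icc s t)).toReal := by
      simp only [hφ]
      rw [h2, ENNReal.toReal_add (hfin _ _) (hfin _ _)]
    rw [h3, add_sub_cancel_left, dist_edist]
    exact ENNReal.toReal_mono (hfin _ _) h1
  have hup : ∀ s t, 0 ≤ s → s ≤ t → φ t - φ s ≤ L * (t - s) := by
    intro s t hs hst
    have h1 : μH[1] (γ '' Icc 0 t) ≤ μH[1] (γ '' Icc 0 s) + L * ENNReal.ofReal (t - s) := by
      rw [hunion s t hs hst]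
      refine (measure_union_le _ _).trans (add_le_add_right ?_ _)
      simpa using hγ.1.hausdorffMeasure_image_le_volume (Icc s t)
    have h2 := ENNReal.toReal_mono (ENNReal.add_ne_top.2 ⟨hfin _ _,
      ENNReal.mul_ne_top ENNReal.coe_ne_top ENNReal.ofReal_ne_top⟩) h1
    rw [ENNReal.toReal_add (hfin _ _) (ENNReal.mul_ne_top ENNReal.coe_ne_top
      ENNReal.ofReal_ne_top), ENNReal.toReal_mul, ENNReal.toReal_ofReal (sub_nonneg.2 hst)] at h2
    rw [sub_le_iff_le_add']
    simpa [hφ] using h2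
  have hφ0 : φ 0 = 0 := by simp [hφ, hausdorffMeasure_one_singleton]
  have hlow' : ∀ s ∈ Icc (0 : ℝ) 1, ∀ t ∈ Icc (0 : ℝ) 1, dist (γ s) (γ t) ≤ |φ s - φ t| := by
    intro s hs t ht
    rcases le_total s t with h | h
    · rw [abs_sub_comm]
      exact (hlow s t hs.1 h ht.2).trans (le_abs_self _)
    · rw [dist_comm]
      exact (hlow t s ht.1 h hs.2).trans (le_abs_self _)
  have hφcont : ContinuousOn φ (Icc 0 1) := by
    refine LipschitzOnWith.continuousOn (K := L) (LipschitzOnWith.of_dist_le_mul ?_)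
    have key : ∀ s t, s ∈ Icc (0 : ℝ) 1 → t ∈ Icc (0 : ℝ) 1 → s ≤ t →
        dist (φ s) (φ t) ≤ L * dist s t := by
      intro s t hs ht hst
      rw [dist_comm, dist_comm s, Real.dist_eq, Real.dist_eq, abs_of_nonneg (sub_nonneg.2 hst),
        abs_of_nonneg (dist_nonneg.trans (hlow s t hs.1 hst ht.2))]
      exact hup s t hs.1 hst
    intro s hs t ht
    rcases le_total s t with h | h
    · exact key s t hs ht h
    · rw [dist_comm, dist_comm s]; exact key t s ht hs h
  have hφ1 : 0 ≤ φ 1 := ENNReal.toReal_nonneg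
  have hex : ∀ u : ℝ, ∃ t ∈ Icc (0 : ℝ) 1, φ t = projIcc 0 1 zero_le_one u * φ 1 := by
    intro u
    have hu := (projIcc (0 : ℝ) 1 zero_le_one u).2
    refine intermediate_value_Icc zero_le_one hφcont ⟨?_, ?_⟩
    · rw [hφ0]; exact mul_nonneg hu.1 hφ1
    · exact mul_le_of_le_one_left hφ1 hu.2
  -- No regularity of `ψ` is needed: by `hlow'`, `γ` at two times is controlled by the values of `φ`
  -- alone.
  choose ψ hψ hψφ using hex
  have h := hmin (φ 1).toNNReal (fun u => γ (ψ u))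
    ⟨LipschitzWith.of_dist_le_mul fun a b => ?_, fun t => hγ.2.1 _, ?_, ?_⟩
  · have h1 : (L : ℝ) ≤ φ 1 := by
      have := NNReal.coe_le_coe.2 h
      rwa [Real.coe_toNNReal _ hφ1] at this
    have h2 : (L : ℝ≥0∞) = ENNReal.ofReal L := by simp
    rw [h2]
    exact (ENNReal.ofReal_le_iff_le_toReal (hfin 0 1)).2 h1
  · refine (hlow' _ (hψ a) _ (hψ b)).trans ?_
    rw [hψφ, hψφ, ← sub_mul, abs_mul, abs_of_nonneg hφ1, mul_comm,
      Real.coe_toNNReal _ hφ1]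
    refine mul_le_mul_of_nonneg_left ?_ hφ1
    have := (LipschitzWith.projIcc (zero_le_one (α := ℝ))).dist_le_mul a b
    simpa [Subtype.dist_eq, Real.dist_eq] using this
  · have h1 := hlow' _ (hψ 0) 0 (by simp)
    rw [hψφ, hφ0] at h1
    rw [← hγ.2.2.1]
    exact dist_le_zero.1 (by simpa [projIcc_left] using h1)
  · have h1 := hlow' _ (hψ 1) 1 (by simp)
    rw [hψφ] at h1
    have : γ (ψ 1) = γ 1 := dist_le_zero.1 (by simpa [projIcc_right] using h1)
    simpa only [this] using hγ.2.2.2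

/-- A curve on `[0, 1]` whose image is at least as long as its Lipschitz constant pushes the
rescaled Lebesgue measure forward to at most the Hausdorff measure of its image. -/
theorem smul_map_le_hausdorffMeasure_restrict {L : ℝ≥0} {γ : ℝ → X} (hγ : LipschitzWith L γ)
    (hL : (L : ℝ≥0∞) ≤ μH[1] (γ '' Icc 0 1)) :
    (L : ℝ≥0∞) • (volume.restrict (Icc 0 1)).map γ ≤ (μH[1]).restrict (γ '' Icc 0 1) := by
  refine Measure.le_iff.2 fun B hB => ?_
  have hpre : MeasurableSet (γ ⁻¹' B) := hγ.continuous.measurable hB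
  rw [Measure.smul_apply, Measure.map_apply hγ.continuous.measurable hB,
    Measure.restrict_apply hpre, Measure.restrict_apply hB, smul_eq_mul, inter_comm B,
    ← image_inter_preimage, inter_comm (γ ⁻¹' B)]
  -- The Lipschitz upper bound off `B`, with the full lower bound on the total, leaves the lower
  -- bound on `B`.
  have h1 : (L : ℝ≥0∞) ≤ μH[1] (γ '' (Icc 0 1 ∩ γ ⁻¹' B)) + L * volume (Icc 0 1 \ γ ⁻¹' B) := by
    refine hL.trans ?_
    rw [← inter_union_sdiff (Icc (0 : ℝ) 1) (γ ⁻¹' B), image_union]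
    refine (measure_union_le _ _).trans ?_
    rw [inter_union_sdiff]
    exact add_le_add_right (hγ.hausdorffMeasure_image_le_volume _) _
  have h2 : (L : ℝ≥0∞) * volume (Icc 0 1 ∩ γ ⁻¹' B) + L * volume (Icc 0 1 \ γ ⁻¹' B) = L := by
    rw [← mul_add, measure_inter_add_sdiff _ hpre]; simp
  have h3 : (L : ℝ≥0∞) * volume (Icc 0 1 \ γ ⁻¹' B) ≠ ∞ :=
    ENNReal.mul_ne_top ENNReal.coe_ne_top
      ((measure_mono sdiff_subset).trans_lt (by simp : volume (Icc (0 : ℝ) 1) < ∞)).ne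
  exact (ENNReal.add_le_add_iff_right h3).1 (h2.trans_le h1)

/-- A point of a continuum `C` of finite length is joined to a closed subset `T` by a curve in `C`
that is parametrized by a multiple of arc length and meets `T` at its end only. -/
theorem exists_curve_to_closed {C T : Set X} (hC : IsPreconnected C) (hCc : IsCompact C)
    (hfin : μH[1] C ≠ ∞) (hT : IsClosed T) (hTC : T ⊆ C) (hTne : T.Nonempty) {x : X}
    (hx : x ∈ C) :
    ∃ (L : ℝ≥0) (γ : ℝ → X), LipschitzWith L γ ∧ (∀ t, γ t ∈ C) ∧ γ 0 = x ∧ γ 1 ∈ T ∧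
      (L : ℝ≥0∞) • (volume.restrict (Icc 0 1)).map γ ≤ (μH[1]).restrict (γ '' Icc 0 1) ∧
      μH[1] (γ '' Icc 0 1 ∩ T) = 0 := by
  obtain ⟨y, hy⟩ := hTne
  obtain ⟨L₀, γ₀, h₀, h₀C, h₀x, h₀y⟩ := exists_lipschitzWith_joining hC hCc hfin hx (hTC hy)
  obtain ⟨L, γ, hγ, hmin⟩ := exists_minimal_isLipschitzJoin hCc hT (x := x)
    ⟨L₀, γ₀, h₀, h₀C, h₀x, h₀y ▸ hy⟩
  refine ⟨L, γ, hγ.1, hγ.2.1, hγ.2.2.1, hγ.2.2.2, smul_map_le_hausdorffMeasure_restrict hγ.1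
    (le_hausdorffMeasure_image_of_minimal hγ hmin), ?_⟩
  refine measure_mono_null (t := {γ 1}) ?_ (hausdorffMeasure_one_singleton _)
  rintro _ ⟨⟨s, hs, rfl⟩, hsT⟩
  exact eq_of_mem_of_minimal hγ hmin hs hsT

end ShortestCurve

/-! ### Trees of curves inside a continuum -/

section CurveTree

variable {X : Type*}

/-- The union of the first `m` curves. -/
def curveTreeImage (m : ℕ) (γ : ℕ → ℝ → X) : Set X :=
  ⋃ k ∈ Finset.range m, γ k '' Icc 0 1

theorem curveTreeImage_succ (m : ℕ) (γ : ℕ → ℝ → X) :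
    curveTreeImage (m + 1) γ = γ m '' Icc 0 1 ∪ curveTreeImage m γ := by
  simp only [curveTreeImage, Finset.range_add_one, Finset.set_biUnion_insert]

theorem curveTreeImage_congr {m : ℕ} {γ γ' : ℕ → ℝ → X} (h : ∀ k < m, γ k = γ' k) :
    curveTreeImage m γ = curveTreeImage m γ' :=
  iUnion₂_congr fun k hk => by rw [h k (Finset.mem_range.1 hk)]

theorem image_subset_curveTreeImage {m k : ℕ} (hk : k < m) (γ : ℕ → ℝ → X) :
    γ k '' Icc 0 1 ⊆ curveTreeImage m γ :=
  subset_biUnion_of_mem (u := fun k => γ k '' Icc 0 1) (Finset.mem_coe.2 (Finset.mem_range.2 hk))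

variable [MetricSpace X]

/-- The curves `γ k`, `k < m`, form a tree through the points `p k`: the `k`-th one starts at
`p k` and, unless `k = 0`, ends at a point of an earlier one. -/
def IsCurveTree (p : ℕ → X) (m : ℕ) (L : ℕ → ℝ≥0) (γ : ℕ → ℝ → X) : Prop :=
  ∀ k < m, LipschitzWith (L k) (γ k) ∧ γ k 0 = p k ∧
    (0 < k → ∃ j < k, ∃ s ∈ Icc (0 : ℝ) 1, γ k 1 = γ j s)

variable {p : ℕ → X} {m : ℕ} {L : ℕ → ℝ≥0} {γ : ℕ → ℝ → X}

theorem IsCurveTree.mono {n : ℕ} (h : IsCurveTree p m L γ) (hn : n ≤ m) : IsCurveTree p n L γ :=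
  fun k hk => h k (hk.trans_le hn)

theorem IsCurveTree.isCompact (h : IsCurveTree p m L γ) : IsCompact (curveTreeImage m γ) :=
  (Finset.range m).isCompact_biUnion fun k hk =>
    isCompact_Icc.image (h k (Finset.mem_range.1 hk)).1.continuous

theorem IsCurveTree.mem (h : IsCurveTree p m L γ) {k : ℕ} (hk : k < m) :
    p k ∈ curveTreeImage m γ :=
  image_subset_curveTreeImage hk γ ⟨0, by simp, (h k hk).2.1⟩

theorem IsCurveTree.isPreconnected (h : IsCurveTree p m L γ) :
    IsPreconnected (curveTreeImage m γ) := by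
  induction m with
  | zero => simpa [curveTreeImage] using isPreconnected_empty
  | succ m ih =>
    have hm := h m m.lt_succ_self
    have hc : IsPreconnected (γ m '' Icc 0 1) :=
      isPreconnected_Icc.image _ hm.1.continuous.continuousOn
    have ht := ih (h.mono m.le_succ)
    rw [curveTreeImage_succ]
    rcases Nat.eq_zero_or_pos m with rfl | hpos
    · simpa [curveTreeImage] using hc
    · obtain ⟨j, hj, s, hs, heq⟩ := hm.2.2 hpos
      exact hc.union (γ m 1) ⟨1, by simp, rfl⟩
        (heq ▸ image_subset_curveTreeImage hj γ (mem_image_of_mem _ hs)) ht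

theorem IsCurveTree.isConnected (h : IsCurveTree p m L γ) (hm : 0 < m) :
    IsConnected (curveTreeImage m γ) :=
  ⟨⟨p 0, h.mem hm⟩, h.isPreconnected⟩

variable [MeasurableSpace X] [BorelSpace X]

/-- The weighted length of a family of curves, counted with multiplicity. -/
noncomputable def curveTreeLength (w : X → ℝ≥0∞) (m : ℕ) (L : ℕ → ℝ≥0) (γ : ℕ → ℝ → X) : ℝ≥0∞ :=
  ∑ k ∈ Finset.range m, ∫⁻ t in Icc (0 : ℝ) 1, L k * w (γ k t)

theorem LipschitzWith.weightedLength_image_le {w : X → ℝ≥0∞} (hw : Measurable w) {K : ℝ≥0}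
    {g : ℝ → X} (hg : LipschitzWith K g) :
    weightedLength w (g '' Icc 0 1) ≤ ∫⁻ t in Icc (0 : ℝ) 1, K * w (g t) := by
  have hgm : Measurable g := hg.continuous.measurable
  have h : (μH[1]).restrict (g '' Icc 0 1) ≤
      (K : ℝ≥0∞) • (volume.restrict (Icc 0 1)).map g := by
    refine Measure.le_iff.2 fun B hB => ?_
    rw [Measure.smul_apply, Measure.map_apply hgm hB, Measure.restrict_apply (hgm hB),
      Measure.restrict_apply hB, smul_eq_mul, inter_comm B, ← image_inter_preimage,
      inter_comm (g ⁻¹' B)]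
    exact hg.hausdorffMeasure_image_le_volume _
  refine (lintegral_mono' h le_rfl).trans_eq ?_
  rw [lintegral_smul_measure, lintegral_map hw hgm, smul_eq_mul,
    lintegral_const_mul' _ _ ENNReal.coe_ne_top]

theorem IsCurveTree.weightedLength_le (h : IsCurveTree p m L γ) {w : X → ℝ≥0∞}
    (hw : Measurable w) : weightedLength w (curveTreeImage m γ) ≤ curveTreeLength w m L γ := by
  induction m with
  | zero => simp [weightedLength, curveTreeImage]
  | succ m ih =>
    rw [curveTreeImage_succ, curveTreeLength, Finset.sum_range_succ, add_comm]
    exact (lintegral_union_le _ _ _).trans (add_le_add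
      ((h m m.lt_succ_self).1.weightedLength_image_le hw) (ih (h.mono m.le_succ)))

/-- A continuum of finite length contains a tree of curves through given points that is no longer
than the continuum, whatever the weight. -/
theorem exists_isCurveTree {C : Set X} (hC : IsConnected C) (hCc : IsCompact C)
    (hfin : μH[1] C ≠ ∞) (hp : ∀ k, p k ∈ C) (m : ℕ) :
    ∃ L γ, IsCurveTree p m L γ ∧
      ∀ w : X → ℝ≥0∞, Measurable w → curveTreeLength w m L γ ≤ weightedLength w C := by
  -- Comparing with the image of the tree, rather than with `C`, lets the induction add lengths.
  suffices H : ∃ L γ, IsCurveTree p m L γ ∧ curveTreeImage m γ ⊆ C ∧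
      ∀ w : X → ℝ≥0∞, Measurable w →
        curveTreeLength w m L γ ≤ weightedLength w (curveTreeImage m γ) by
    obtain ⟨L, γ, h1, h2, h3⟩ := H
    exact ⟨L, γ, h1, fun w hw => (h3 w hw).trans (lintegral_mono_set h2)⟩
  induction m with
  | zero =>
    exact ⟨0, fun k _ => p k, fun k hk => absurd hk (Nat.not_lt_zero k), by simp [curveTreeImage],
      fun w _ => by simp [curveTreeLength]⟩
  | succ m ih =>
    obtain ⟨L, γ, htree, hsub, hlen⟩ := ih
    -- The target is the tree built so far. For the first curve it is all of `C`, which forces that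
    -- curve to have zero length.
    have hT : ∃ T, IsClosed T ∧ T ⊆ C ∧ T.Nonempty ∧ curveTreeImage m γ ⊆ T ∧
        (0 < m → T = curveTreeImage m γ) := by
      rcases Nat.eq_zero_or_pos m with rfl | hm
      · exact ⟨C, hCc.isClosed, subset_rfl, hC.nonempty, hsub, fun h => absurd h (lt_irrefl 0)⟩
      · exact ⟨_, htree.isCompact.isClosed, hsub, ⟨p 0, htree.mem hm⟩, subset_rfl, fun _ => rfl⟩
    obtain ⟨T, hTc, hTC, hTne, hTsub, hTeq⟩ := hT
    obtain ⟨K, g, hg, hgC, hg0, hg1, hgle, hgnull⟩ :=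
      exists_curve_to_closed hC.isPreconnected hCc hfin hTc hTC hTne (hp m)
    have hγ : ∀ k < m, Function.update γ m g k = γ k := fun k hk =>
      Function.update_of_ne hk.ne _ _
    have hL : ∀ k < m, Function.update L m K k = L k := fun k hk =>
      Function.update_of_ne hk.ne _ _
    have himg : curveTreeImage (m + 1) (Function.update γ m g) =
        g '' Icc 0 1 ∪ curveTreeImage m γ := by
      rw [curveTreeImage_succ, Function.update_self, curveTreeImage_congr hγ]
    refine ⟨Function.update L m K, Function.update γ m g, fun k hk => ?_, ?_, fun w hw => ?_⟩
    · rcases eq_or_lt_of_le (Nat.le_of_lt_succ hk) with rfl | hk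
      · rw [Function.update_self, Function.update_self]
        refine ⟨hg, hg0, fun hpos => ?_⟩
        rw [hTeq hpos] at hg1
        simp only [curveTreeImage, mem_iUnion, Finset.mem_range] at hg1
        obtain ⟨j, hj, s, hs, heq⟩ := hg1
        exact ⟨j, hj, s, hs, by rw [hγ j hj, heq]⟩
      · rw [hγ k hk, hL k hk]
        refine ⟨(htree k hk).1, (htree k hk).2.1, fun hpos => ?_⟩
        obtain ⟨j, hj, s, hs, heq⟩ := (htree k hk).2.2 hpos
        exact ⟨j, hj, s, hs, by rw [hγ j (hj.trans hk), heq]⟩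
    · rw [himg]
      exact union_subset (image_subset_iff.2 fun t _ => hgC t) hsub
    · have hgm : Measurable g := hg.continuous.measurable
      have h1 : ∫⁻ t in Icc (0 : ℝ) 1, K * w (g t) ≤ weightedLength w (g '' Icc 0 1) := by
        refine le_trans (le_of_eq ?_) (lintegral_mono' hgle le_rfl)
        rw [lintegral_smul_measure, lintegral_map hw hgm, smul_eq_mul,
          lintegral_const_mul' _ _ ENNReal.coe_ne_top]
      have h2 : curveTreeLength w (m + 1) (Function.update L m K) (Function.update γ m g) =
          curveTreeLength w m L γ + ∫⁻ t in Icc (0 : ℝ) 1, K * w (g t) := by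
        rw [curveTreeLength, Finset.sum_range_succ, Function.update_self, Function.update_self]
        congr 1
        exact Finset.sum_congr rfl fun k hk => by
          rw [hγ k (Finset.mem_range.1 hk), hL k (Finset.mem_range.1 hk)]
      have hnull : AEDisjoint μH[1] (g '' Icc 0 1) (curveTreeImage m γ) :=
        measure_mono_null (inter_subset_inter_right _ hTsub) hgnull
      have hmeas : MeasurableSet (curveTreeImage m γ) := htree.isCompact.isClosed.measurableSet
      rw [h2, himg, add_comm, weightedLength,
        Measure.restrict_union₀ hnull hmeas.nullMeasurableSet, lintegral_add_measure]
      exact add_le_add h1 (hlen w hw)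

end CurveTree

/-! ### Weak* limits of trees and lower semicontinuity of length -/

section WeakStarLimit

theorem tendsto_of_lipschitzWith_of_dense {α β ι : Type*} [PseudoMetricSpace α]
    [PseudoMetricSpace β] {l : Filter ι} {F : ι → α → β} {f : α → β} {K : ℝ≥0}
    (hF : ∀ i, LipschitzWith K (F i)) (hf : Continuous f) {s : Set α} (hs : Dense s)
    (h : ∀ x ∈ s, Tendsto (F · x) l (𝓝 (f x))) (x : α) : Tendsto (F · x) l (𝓝 (f x)) :=
  ((LipschitzWith.uniformEquicontinuous F K hF).equicontinuous x).tendsto_of_mem_closure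
    (hf.continuousAt.mono_left inf_le_left) h (hs x)

/-- Fatou's lemma for counting measure. -/
theorem sum_liminf_le_liminf_sum (s : Finset ℕ) (f : ℕ → ℕ → ℝ≥0∞) :
    ∑ k ∈ s, liminf (fun n => f n k) atTop ≤ liminf (fun n => ∑ k ∈ s, f n k) atTop := by
  have h := lintegral_liminf_le (u := (atTop : Filter ℕ))
    (μ := (Measure.count : Measure ℕ).restrict s) (f := f)
    fun n => measurable_from_nat
  simpa [lintegral_finset] using h

variable {Y : Type*} [NormedAddCommGroup Y] [NormedSpace ℝ Y]

theorem lipschitzWith_eval {K : ℝ≥0} {g : ℝ → StrongDual ℝ Y} (hg : LipschitzWith K g) (y : Y) :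
    LipschitzWith (K * ‖y‖₊) fun t => g t y :=
  LipschitzWith.of_dist_le_mul fun s t => by
    rw [Real.dist_eq, ← Real.norm_eq_abs, ← sub_apply]
    refine ((g s - g t).le_opNorm y).trans ?_
    have := hg.dist_le_mul s t
    rw [dist_eq_norm] at this
    rw [NNReal.coe_mul, coe_nnnorm, mul_right_comm]
    exact mul_le_mul_of_nonneg_right this (norm_nonneg y)

theorem lipschitzWith_of_eval {K : ℝ≥0} {g : ℝ → StrongDual ℝ Y}
    (h : ∀ y, LipschitzWith (K * ‖y‖₊) fun t => g t y) : LipschitzWith K g :=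
  LipschitzWith.of_dist_le_mul fun s t => by
    rw [dist_eq_norm]
    refine ContinuousLinearMap.opNorm_le_bound _ (by positivity) fun y => ?_
    have := (h y).dist_le_mul s t
    rwa [Real.dist_eq, ← Real.norm_eq_abs, ← sub_apply, NNReal.coe_mul,
      coe_nnnorm, mul_right_comm] at this

theorem norm_le_of_lipschitzWith {K : ℝ≥0} {g : ℝ → StrongDual ℝ Y} (hg : LipschitzWith K g)
    (t : ℝ) : ‖g t‖ ≤ ‖g 0‖ + K * |t| := by
  have h1 := hg.dist_le_mul t 0
  rw [dist_eq_norm, Real.dist_eq, sub_zero] at h1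
  linarith [norm_le_norm_add_norm_sub (g 0) (g t), norm_sub_rev (g 0) (g t)]

/-- Weak* limits, along an ultrafilter, of equi-Lipschitz curves with a fixed starting point. -/
theorem exists_weakStar_limit_curve (𝒰 : Ultrafilter ℕ) {M : ℝ≥0} {L : ℕ → ℝ≥0}
    {σ : ℕ → ℝ → StrongDual ℝ Y} {p : StrongDual ℝ Y} (hσ : ∀ n, LipschitzWith (L n) (σ n))
    (hM : ∀ n, L n ≤ M) (h0 : ∀ n, σ n 0 = p) :
    ∃ (K : ℝ≥0) (g : ℝ → StrongDual ℝ Y), LipschitzWith K g ∧ g 0 = p ∧ Tendsto L 𝒰 (𝓝 K) ∧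
      ∀ t y, Tendsto (fun n => σ n t y) 𝒰 (𝓝 (g t y)) := by
  obtain ⟨K, -, hK⟩ := (isCompact_Icc (a := (0 : ℝ≥0)) (b := M)).ultrafilter_le_nhds (𝒰.map L)
    (le_principal_iff.2 (Ultrafilter.mem_map.2 (univ_mem' fun n => ⟨zero_le, hM n⟩)))
  -- Banach–Alaoglu: at time `t` all curves lie in the ball of radius `‖p‖ + M * |t|`.
  have h : ∀ t, ∃ z : WeakDual ℝ Y,
      Tendsto (fun n => StrongDual.toWeakDual (σ n t)) (𝒰 : Filter ℕ) (𝓝 z) := fun t => by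
    obtain ⟨z, -, hz⟩ := (WeakDual.isCompact_closedBall (0 : StrongDual ℝ Y)
      (‖p‖ + M * |t|)).ultrafilter_le_nhds (𝒰.map fun n => StrongDual.toWeakDual (σ n t))
      (le_principal_iff.2 (Ultrafilter.mem_map.2 (univ_mem' fun n => by
        have h1 := norm_le_of_lipschitzWith ((hσ n).weaken (hM n)) t
        rw [h0] at h1
        simpa using h1)))
    exact ⟨z, hz⟩
  choose z hz using h
  have heval : ∀ t y, Tendsto (fun n => σ n t y) 𝒰 (𝓝 (z t y)) := fun t =>
    tendsto_iff_forall_eval_tendsto_topDualPairing.1 (hz t)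
  refine ⟨K, fun t => WeakDual.toStrongDual (z t), lipschitzWith_of_eval fun y => ?_, ?_, hK,
    heval⟩
  · refine LipschitzWith.of_dist_le_mul fun s t => ?_
    have h1 : Tendsto (fun n => ((L n * ‖y‖₊ : ℝ≥0) : ℝ) * dist s t) 𝒰
        (𝓝 (((K * ‖y‖₊ : ℝ≥0) : ℝ) * dist s t)) :=
      (NNReal.tendsto_coe.2 (Tendsto.mul_const _ hK)).mul_const _
    exact le_of_tendsto_of_tendsto' ((heval s y).dist (heval t y)) h1 fun n =>
      (lipschitzWith_eval (hσ n) y).dist_le_mul s t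
  · ext y
    have := heval 0 y
    simp only [h0] at this
    exact (tendsto_nhds_unique this tendsto_const_nhds)

/-- Equi-Lipschitz trees of curves in the dual of a separable space converge, up to a subsequence,
to such a tree, weakly* at every time. -/
theorem exists_weakStar_limit_curveTree [TopologicalSpace.SeparableSpace Y]
    {p : ℕ → StrongDual ℝ Y} {m : ℕ} {M : ℝ≥0} {L : ℕ → ℕ → ℝ≥0}
    {γ : ℕ → ℕ → ℝ → StrongDual ℝ Y} (h : ∀ n, IsCurveTree p m (L n) (γ n))
    (hM : ∀ n, ∀ k < m, L n k ≤ M) :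
    ∃ (K : ℕ → ℝ≥0) (g : ℕ → ℝ → StrongDual ℝ Y) (ψ : ℕ → ℕ), StrictMono ψ ∧
      IsCurveTree p m K g ∧ ∀ k < m, Tendsto (fun n => L (ψ n) k) atTop (𝓝 (K k)) ∧
        ∀ t y, Tendsto (fun n => γ (ψ n) k t y) atTop (𝓝 (g k t y)) := by
  set 𝒰 : Ultrafilter ℕ := hyperfilter ℕ with h𝒰
  have hlim : ∀ k, ∃ (K : ℝ≥0) (g : ℝ → StrongDual ℝ Y), k < m → LipschitzWith K g ∧ g 0 = p k ∧
      Tendsto (fun n => L n k) 𝒰 (𝓝 K) ∧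
        ∀ t y, Tendsto (fun n => γ n k t y) 𝒰 (𝓝 (g t y)) := fun k => by
    by_cases hk : k < m
    · obtain ⟨K, g, h1⟩ := exists_weakStar_limit_curve 𝒰 (fun n => (h n k hk).1)
        (fun n => hM n k hk) fun n => (h n k hk).2.1
      exact ⟨K, g, fun _ => h1⟩
    · exact ⟨0, 0, fun h => absurd h hk⟩
  choose K g hg using hlim
  have htree : IsCurveTree p m K g := by
    refine fun k hk => ⟨(hg k hk).1, (hg k hk).2.1, fun hpos => ?_⟩
    have hex : ∀ᶠ n in (𝒰 : Filter ℕ), ∃ j ∈ Iio k, ∃ s ∈ Icc (0 : ℝ) 1, γ n k 1 = γ n j s :=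
      Eventually.of_forall fun n => (h n k hk).2.2 hpos
    -- The ultrafilter selects one of the finitely many possible parents; the attaching times then
    -- converge along it.
    obtain ⟨j, hj, hjev⟩ := (Ultrafilter.eventually_exists_mem_iff (finite_Iio k)).1 hex
    have hs : ∀ n, ∃ s ∈ Icc (0 : ℝ) 1,
        (∃ s ∈ Icc (0 : ℝ) 1, γ n k 1 = γ n j s) → γ n k 1 = γ n j s := fun n => by
      by_cases hn : ∃ s ∈ Icc (0 : ℝ) 1, γ n k 1 = γ n j s
      · obtain ⟨s, hs, heq⟩ := hn
        exact ⟨s, hs, fun _ => heq⟩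
      · exact ⟨0, by simp, fun h => absurd h hn⟩
    choose s hsI hs using hs
    obtain ⟨a, ha, hsa⟩ := (isCompact_Icc (a := (0 : ℝ)) (b := 1)).ultrafilter_le_nhds (𝒰.map s)
      (le_principal_iff.2 (Ultrafilter.mem_map.2 (univ_mem' hsI)))
    have hjm : j < m := lt_trans hj hk
    refine ⟨j, hj, a, ha, ?_⟩
    ext y
    have h1 := (hg k hk).2.2.2 1 y
    have h2 := (hg j hjm).2.2.2 a y
    have h3 : Tendsto (fun n => γ n j (s n) y - γ n j a y) 𝒰 (𝓝 0) := by
      have h4 : Tendsto (fun n => ((M * ‖y‖₊ : ℝ≥0) : ℝ) * dist (s n) a) 𝒰 (𝓝 0) := by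
        have h5 : Tendsto s 𝒰 (𝓝 a) := hsa
        simpa using (h5.dist (tendsto_const_nhds (x := a))).const_mul ((M * ‖y‖₊ : ℝ≥0) : ℝ)
      refine squeeze_zero_norm (fun n => ?_) h4
      rw [← dist_eq_norm]
      exact (lipschitzWith_eval ((h n j hjm).1.weaken (hM n j hjm)) y).dist_le_mul _ _
    have h6 : Tendsto (fun n => γ n j (s n) y) 𝒰 (𝓝 (g j a y)) := by
      simpa using h3.add h2
    refine tendsto_nhds_unique (h1.congr' ?_) h6
    filter_upwards [hjev] with n hn
    rw [hs n hn]
  -- Fatou's lemma will need a sequence. Constants and evaluations at rational times and dense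
  -- vectors are countably many data, so a subsequence converges to the ultrafilter limit;
  -- equicontinuity in time, then in the vector, gives the rest.
  set u : ℕ → (Fin m → ℝ≥0) × (Fin m × ℚ × ℕ → ℝ) := fun n =>
    (fun k => L n k, fun i => γ n i.1 (i.2.1 : ℝ) (TopologicalSpace.denseSeq Y i.2.2)) with hu
  have hclust : Tendsto u 𝒰 (𝓝 (fun k : Fin m => K k, fun i : Fin m × ℚ × ℕ =>
      g i.1 (i.2.1 : ℝ) (TopologicalSpace.denseSeq Y i.2.2))) :=
    Tendsto.prodMk_nhds (tendsto_pi_nhds.2 fun k => (hg k k.2).2.2.1)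
      (tendsto_pi_nhds.2 fun i => (hg i.1 i.1.2).2.2.2 _ _)
  obtain ⟨ψ, hψ, hψu⟩ := (hclust.mapClusterPt.mono Nat.hyperfilter_le_atTop).tendsto_subseq
  have hψL := tendsto_pi_nhds.1 ((continuous_fst.tendsto _).comp hψu)
  have hψγ := tendsto_pi_nhds.1 ((continuous_snd.tendsto _).comp hψu)
  refine ⟨K, g, ψ, hψ, htree, fun k hk => ⟨hψL ⟨k, hk⟩, fun t y => ?_⟩⟩
  have hlip : ∀ n, LipschitzWith M (γ (ψ n) k) := fun n =>
    (h (ψ n) k hk).1.weaken (hM (ψ n) k hk)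
  refine tendsto_of_lipschitzWith_of_dense (F := fun n t => γ (ψ n) k t y)
    (f := fun t => g k t y) (fun n => lipschitzWith_eval (hlip n) y)
    (lipschitzWith_eval (hg k hk).1 y).continuous (Rat.denseRange_cast (𝕜 := ℝ)) ?_ t
  rintro _ ⟨q, rfl⟩
  refine tendsto_of_lipschitzWith_of_dense (F := fun n y => γ (ψ n) k q y)
    (f := fun y => g k q y) (K := ‖p k‖₊ + M * ‖(q : ℝ)‖₊) (fun n => ?_) (g k q).continuous
    (TopologicalSpace.denseRange_denseSeq Y) ?_ y
  · refine (γ (ψ n) k q).lipschitz.weaken ?_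
    have := norm_le_of_lipschitzWith (hlip n) q
    rw [(h (ψ n) k hk).2.1] at this
    exact this
  · rintro _ ⟨i, rfl⟩
    exact hψγ (⟨k, hk⟩, q, i)

theorem WeakStarLowerSemicontinuous.measurable {w : StrongDual ℝ Y → ℝ≥0∞}
    (hw : WeakStarLowerSemicontinuous w) : Measurable w :=
  LowerSemicontinuous.measurable fun x c hc =>
    (NormedSpace.Dual.toWeakDual_continuous.tendsto x).eventually (hw (StrongDual.toWeakDual x) c hc)

theorem WeakStarLowerSemicontinuous.le_liminf {w : StrongDual ℝ Y → ℝ≥0∞}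
    (hw : WeakStarLowerSemicontinuous w) {u : ℕ → StrongDual ℝ Y} {x : StrongDual ℝ Y}
    (hu : ∀ y, Tendsto (fun n => u n y) atTop (𝓝 (x y))) :
    w x ≤ liminf (fun n => w (u n)) atTop := by
  have h : Tendsto (fun n => StrongDual.toWeakDual (u n)) atTop (𝓝 (StrongDual.toWeakDual x)) :=
    tendsto_iff_forall_eval_tendsto_topDualPairing.2 hu
  refine le_of_forall_lt fun c hc => ?_
  obtain ⟨d, hcd, hd⟩ := exists_between hc
  have h1 : ∀ᶠ n in atTop, d < w (u n) := h.eventually (hw (StrongDual.toWeakDual x) d hd)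
  exact hcd.trans_le (le_liminf_of_le (by isBoundedDefault) (h1.mono fun _ => le_of_lt))

/-- Fatou's lemma is applied over the curves and over time; convergence at each fixed time suffices.
-/
theorem curveTreeLength_le_liminf {w : StrongDual ℝ Y → ℝ≥0∞}
    (hw : WeakStarLowerSemicontinuous w) {m : ℕ} {L : ℕ → ℕ → ℝ≥0}
    {γ : ℕ → ℕ → ℝ → StrongDual ℝ Y} {K : ℕ → ℝ≥0} {g : ℕ → ℝ → StrongDual ℝ Y}
    (hγ : ∀ n, ∀ k < m, Continuous (γ n k))
    (hL : ∀ k < m, Tendsto (fun n => L n k) atTop (𝓝 (K k)))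
    (hg : ∀ k < m, ∀ t y, Tendsto (fun n => γ n k t y) atTop (𝓝 (g k t y))) :
    curveTreeLength w m K g ≤ liminf (fun n => curveTreeLength w m (L n) (γ n)) atTop := by
  refine le_trans (Finset.sum_le_sum fun k hk => ?_) (sum_liminf_le_liminf_sum _ _)
  have hkm := Finset.mem_range.1 hk
  refine le_trans (lintegral_mono fun t => ?_) (lintegral_liminf_le fun n =>
    (hw.measurable.comp (hγ n k hkm).measurable).const_mul _)
  have h1 : liminf (fun n => (L n k : ℝ≥0∞)) atTop = K k :=
    (ENNReal.tendsto_coe.2 (hL k hkm)).liminf_eq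
  rw [← h1]
  exact (mul_le_mul_right (hw.le_liminf (hg k hkm t)) _).trans ENNReal.le_liminf_mul

end WeakStarLimit

/-! ### The minimizing sequence and the existence proof -/

theorem le_of_curveTreeLength_one_le {X : Type*} [MetricSpace X] [MeasurableSpace X]
    [BorelSpace X] {m : ℕ} {L : ℕ → ℝ≥0} {γ : ℕ → ℝ → X} {M : ℝ≥0}
    (h : curveTreeLength (fun _ => 1) m L γ ≤ M) {k : ℕ} (hk : k < m) : L k ≤ M := by
  have h1 : (L k : ℝ≥0∞) ≤ curveTreeLength (fun _ => 1) m L γ := by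
    have := Finset.single_le_sum (f := fun k => ∫⁻ t in Icc (0 : ℝ) 1, (L k : ℝ≥0∞) * 1)
      (fun _ _ => zero_le) (Finset.mem_range.2 hk)
    refine le_trans (le_of_eq ?_) this
    simp
  exact_mod_cast h1.trans h

theorem exists_seq_steinerCompetitors {X : Type*} [MetricSpace X] [MeasurableSpace X]
    [BorelSpace X] {F : Set X} {w : X → ℝ≥0∞} (h : steinerInf F w < ∞) (n : ℕ) :
    ∃ C ∈ steinerCompetitors F, weightedLength w C ≤ steinerInf F w + ((n : ℝ≥0∞) + 1)⁻¹ := by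
  have h1 : steinerInf F w < steinerInf F w + ((n : ℝ≥0∞) + 1)⁻¹ :=
    ENNReal.lt_add_right h.ne (by simp)
  conv_lhs at h1 => rw [steinerInf]
  simp only [iInf_lt_iff] at h1
  obtain ⟨C, hC, hlt⟩ := h1
  exact ⟨C, hC, hlt.le⟩

theorem hausdorffMeasure_le_weightedLength_div {X : Type*} [MetricSpace X] [MeasurableSpace X]
    [BorelSpace X] {w : X → ℝ≥0∞} (hw : 0 < ⨅ x, w x) {C : Set X}
    (hC : weightedLength w C ≠ ∞) : μH[1] C ≤ weightedLength w C / ⨅ x, w x := by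
  rw [ENNReal.le_div_iff_mul_le (Or.inl hw.ne') (Or.inr hC), mul_comm]
  calc (⨅ x, w x) * μH[1] C = ∫⁻ _ in C, (⨅ x, w x) ∂μH[1] := by simp
    _ ≤ _ := lintegral_mono fun x => iInf_le w x

theorem mainTheorem3 {Y : Type*} [NormedAddCommGroup Y] [NormedSpace ℝ Y]
    [TopologicalSpace.SeparableSpace Y]
    (F : Set (StrongDual ℝ Y)) (hF : F.Finite) (hF_ne : F.Nonempty)
    (w : StrongDual ℝ Y → ℝ≥0∞) (hw : WeakStarLowerSemicontinuous w)
    (hw_pos : 0 < ⨅ x, w x)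
    (h_fin : steinerInf F w < ∞) :
    ∃ C : Set (StrongDual ℝ Y), IsSteinerMinimizer F w C := by
  obtain ⟨p, m, hm, hpF, hFp⟩ : ∃ (p : ℕ → StrongDual ℝ Y) (m : ℕ), 0 < m ∧ (∀ k, p k ∈ F) ∧
      ∀ x ∈ F, ∃ k < m, p k = x := by
    obtain ⟨p₀, hp₀⟩ := hF_ne
    obtain ⟨m, f, -, rfl⟩ := hF.fin_param
    obtain ⟨i, -⟩ := id hp₀
    -- The default `p₀` keeps every `p k` in `F`, as `exists_isCurveTree` requires for all `k`.
    refine ⟨fun k => if hk : k < m then f ⟨k, hk⟩ else p₀, m, i.pos, fun k => ?_, ?_⟩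
    · dsimp only
      split_ifs
      exacts [mem_range_self _, hp₀]
    · rintro _ ⟨j, rfl⟩
      exact ⟨j, j.2, by simp⟩
  choose C hC hCle using exists_seq_steinerCompetitors h_fin
  set I := steinerInf F w with hI
  have hbound : ∀ n, weightedLength w (C n) ≤ I + 1 := fun n =>
    (hCle n).trans (add_le_add_right (ENNReal.inv_le_one.2 le_add_self) _)
  have hI1 : I + 1 ≠ ∞ := ENNReal.add_ne_top.2 ⟨h_fin.ne, ENNReal.one_ne_top⟩
  have hM : (I + 1) / (⨅ x, w x) ≠ ∞ := ENNReal.div_ne_top hI1 hw_pos.ne'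
  lift (I + 1) / (⨅ x, w x) to ℝ≥0 using hM with M hMeq
  have hlen : ∀ n, μH[1] (C n) ≤ M := fun n => by
    rw [hMeq]
    exact (hausdorffMeasure_le_weightedLength_div hw_pos
      ((hbound n).trans_lt hI1.lt_top).ne).trans (ENNReal.div_le_div_right (hbound n) _)
  choose L γ htree hle using fun n => exists_isCurveTree (hC n).2.1 (hC n).1
    ((hlen n).trans_lt ENNReal.coe_lt_top).ne (fun k => (hC n).2.2 (hpF k)) m
  -- The tree bound holds for every weight; weight 1 controls the Lipschitz constants.
  have hLM : ∀ n, ∀ k < m, L n k ≤ M := fun n k hk =>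
    le_of_curveTreeLength_one_le (((hle n _ measurable_const).trans_eq
      (by simp [weightedLength])).trans (hlen n)) hk
  obtain ⟨K, g, ψ, hψ, hg, hlim⟩ := exists_weakStar_limit_curveTree htree hLM
  refine ⟨curveTreeImage m g, ⟨hg.isCompact, hg.isConnected hm, fun x hx => ?_⟩,
    fun C' hC' => ?_⟩
  · obtain ⟨k, hk, rfl⟩ := hFp x hx
    exact hg.mem hk
  · have h1 : Tendsto (fun n => I + ((ψ n : ℝ≥0∞) + 1)⁻¹) atTop (𝓝 I) := by
      have h2 : Tendsto (fun n : ℕ => I + ((n : ℝ≥0∞) + 1)⁻¹) atTop (𝓝 (I + 0)) := by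
        refine tendsto_const_nhds.add ?_
        have := (tendsto_add_atTop_iff_nat 1).2 ENNReal.tendsto_inv_nat_nhds_zero
        simpa using this
      rw [add_zero] at h2
      exact h2.comp hψ.tendsto_atTop
    calc weightedLength w (curveTreeImage m g)
        ≤ curveTreeLength w m K g := hg.weightedLength_le hw.measurable
      _ ≤ liminf (fun n => curveTreeLength w m (L (ψ n)) (γ (ψ n))) atTop :=
        curveTreeLength_le_liminf hw (fun n k hk => (htree (ψ n) k hk).1.continuous)
          (fun k hk => (hlim k hk).1) fun k hk => (hlim k hk).2
      _ ≤ liminf (fun n => I + ((ψ n : ℝ≥0∞) + 1)⁻¹) atTop :=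
        liminf_le_liminf (Eventually.of_forall fun n =>
          (hle (ψ n) w hw.measurable).trans (hCle (ψ n)))
      _ = I := h1.liminf_eq
      _ ≤ weightedLength w C' := iInf₂_le C' hC'
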